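/- Let $K$ be a field of characteristic zero, let $r \ge 1$ be an integer, let $a, b_1, \dots, b_r \in K[x]$, and let $$D = \partial_x + \sum_{j=1}^r \bigl(a(x)\, y_j + b_j(x)\bigr)\, \partial_j$$ be the associated Shamsuddin derivation of $R = K[x, y_1, \dots, y_r]$, where $\partial_x = \partial/\partial x$ and $\partial_j = \partial/\partial y_j$. Call $D$ simple if the only ideals $I$ of $R$ with $D(I) \subseteq I$ are $0$ and $R$, and let $\operatorname{Aut}(R)_D$ be the group of all $K$-algebra automorphisms $\rho$ of $R$ with $\rho D = D \rho$. Then: (i) $D$ is simple if and only if $\operatorname{Aut}(R)_D = \{\mathrm{id}\}$. (ii) Let $(k_1, \dots, k_r) \in K^r \setminus \{(0,\dots,0)\}$ and suppose that $Q \in K[x]$ is a solution of $z' = a(x) z + \sum_{j=1}^r k_j b_j(x)$. Then for every index $i$ with $k_i \ne 0$ and every $e \in K$ with $e \ne 0$ and $e k_i \ne 1$, there is a $\rho \in \operatorname{Aut}(R)_D$ with $\rho \ne \mathrm{id}$ such that $$\rho(x) = x, \qquad \rho(y_j) = y_j \ (j \ne i), \qquad \rho(y_i) = (1 - e k_i)\,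 y_i - e \sum_{j \ne i} k_j y_j + e\, Q(x).$$ -/

import Mathlib

open MvPolynomial

noncomputable section

namespace ShamsuddinIsotropy

/-- An ideal `I` is `D`-stable if `D(I) ⊆ I`. -/
def IsStable {K A : Type*} [CommRing K] [CommRing A] [Algebra K A]
    (D : Derivation K A A) (I : Ideal A) : Prop :=
  ∀ f ∈ I, D f ∈ I

/-- A `K`-derivation `D` of `A` is simple if `A` has no `D`-stable ideals other than `0` and `A`. -/
def IsSimpleDerivation {K A : Type*} [CommRing K] [CommRing A] [Algebra K A]
    (D : Derivation K A A) : Prop :=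
  ∀ I : Ideal A, IsStable D I → I = ⊥ ∨ I = ⊤

/-- The isotropy group `Aut(A)_D` of `D`: the `K`-algebra automorphisms `ρ` of `A`
with `ρ D = D ρ`. -/
def isotropyGroup {K A : Type*} [CommRing K] [CommRing A] [Algebra K A]
    (D : Derivation K A A) : Subgroup (A ≃ₐ[K] A) where
  carrier := {ρ | ∀ f : A, ρ (D f) = D (ρ f)}
  mul_mem' := by
    intro ρ σ hρ hσ f
    change ρ (σ (D f)) = D (ρ (σ f))
    rw [hσ f, hρ (σ f)]
  one_mem' := fun _ => rfl
  inv_mem' := by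
    intro ρ hρ f
    change ρ.symm (D f) = D (ρ.symm f)
    apply ρ.injective
    rw [hρ (ρ.symm f), ρ.apply_symm_apply, ρ.apply_symm_apply]

/-- The polynomial ring `K[x, y_1, …, y_r]`: the indeterminate `x` has index `none`,
and `y_j` has index `some j`. -/
abbrev PolyRing (K : Type*) [Field K] (r : ℕ) : Type _ := MvPolynomial (Option (Fin r)) K

/-- The inclusion of `K[x]` in `K[x, y_1, …, y_r]`. -/
def inX {K : Type*} [Field K] {r : ℕ} : Polynomial K →ₐ[K] PolyRing K r :=
  Polynomial.aeval (X none)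

/-- The Shamsuddin derivation `∂_x + ∑_j (a_j(x) y_j + b_j(x)) ∂_j` of `K[x, y_1, …, y_r]`. -/
def shamsuddin {K : Type*} [Field K] {r : ℕ} (a b : Fin r → Polynomial K) :
    Derivation K (PolyRing K r) (PolyRing K r) :=
  pderiv none + ∑ j : Fin r, (inX (a j) * X (some j) + inX (b j)) • pderiv (some j)

end ShamsuddinIsotropy

end

/-! View `R` as polynomials in the `y_j` over `K[x]`. On coefficients of top `y`-degree `d`, `D`
acts as `z ↦ z' + d a z`.

Not simple implies nontrivial isotropy: a minimal element `f` of a proper nonzero stable ideal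
satisfies `D f = d a f` (`exists_darboux`). Its top coefficients are constants, and one coefficient
of degree `d - 1` solves `z' = a z + ∑ k_j b_j` with `k ≠ 0`. For such a solution `Q`, the form `ℓ =
∑ k_j y_j - Q` satisfies `D ℓ = a ℓ`, so `y_i - e ℓ` obeys the same equation as `y_i`. The resulting
shear commutes with `D`, which also gives (ii).

Simple implies trivial isotropy: Darboux elements are constants, so `ρ(x) = x + c`, and `a` is not
constant. A top coefficient of `ρ(y_i)` forces `a(x + c) = a(x)`, hence `c = 0`. Then each `ρ(y_j) -
y_j` is Darboux, hence a constant, and it vanishes because `a ≠ 0`. -/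

namespace ShamsuddinIsotropy

section

variable {K : Type*} [Field K] {r : ℕ}

/-! ### Coefficients with respect to the `y_j` -/

/-- The coefficient in `K[x]` of the monomial `y ^ m`. -/
noncomputable def ycoeff (m : Fin r →₀ ℕ) : PolyRing K r →ₗ[K] Polynomial K where
  toFun f := coeff m (optionEquivRight K (Fin r) f)
  map_add' f g := by simp
  map_smul' c f := by simp

theorem ycoeff_apply (m : Fin r →₀ ℕ) (f : PolyRing K r) :
    ycoeff m f = coeff m (optionEquivRight K (Fin r) f) := rfl

theorem optionEquivRight_inX (p : Polynomial K) :
    optionEquivRight K (Fin r) (inX p) = C p := by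
  have h : ((optionEquivRight K (Fin r)).toAlgHom.comp inX) =
      (Algebra.ofId (Polynomial K) (MvPolynomial (Fin r) (Polynomial K))).restrictScalars K := by
    ext
    simp [inX, Algebra.ofId_apply, algebraMap_eq]
  exact DFunLike.congr_fun h p

theorem ycoeff_ext {f g : PolyRing K r} (h : ∀ m, ycoeff m f = ycoeff m g) : f = g :=
  (optionEquivRight K (Fin r)).injective (MvPolynomial.ext _ _ h)

theorem ycoeff_inX_mul (m : Fin r →₀ ℕ) (p : Polynomial K) (f : PolyRing K r) :
    ycoeff m (inX p * f) = p * ycoeff m f := by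
  simp only [ycoeff_apply, map_mul, optionEquivRight_inX, coeff_C_mul]

theorem ycoeff_inX (m : Fin r →₀ ℕ) (p : Polynomial K) :
    ycoeff (r := r) m (inX p) = if 0 = m then p else 0 := by
  classical
  simp only [ycoeff_apply, optionEquivRight_inX, coeff_C]

theorem optionEquivRight_pderiv_some (j : Fin r) (f : PolyRing K r) :
    optionEquivRight K (Fin r) (pderiv (some j) f) =
      pderiv j (optionEquivRight K (Fin r) f) := by
  classical
  induction f using MvPolynomial.induction_on with
  | C c => simp [optionEquivRight_C, -optionEquivRight_apply]
  | add p q hp hq => simp only [map_add, hp, hq]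
  | mul_X p i hp =>
    cases i with
    | none => simp [hp, optionEquivRight_X_none, -optionEquivRight_apply]
    | some i =>
      by_cases h : j = i
      · subst h
        simp [hp, optionEquivRight_X_some, -optionEquivRight_apply]
      · simp [hp, optionEquivRight_X_some, Ne.symm h, -optionEquivRight_apply]

theorem ycoeff_pderiv_none (m : Fin r →₀ ℕ) (f : PolyRing K r) :
    ycoeff m (pderiv none f) = Polynomial.derivative (ycoeff m f) := by
  classical
  induction f using MvPolynomial.induction_on generalizing m with
  | C c =>
    simp only [ycoeff_apply, pderiv_C, map_zero, optionEquivRight_C, coeff_C]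
    split_ifs <;> simp
  | add p q hp hq => simp [hp, hq]
  | mul_X p i hp =>
    simp only [ycoeff_apply] at hp
    cases i with
    | none =>
      simp only [ycoeff_apply, pderiv_mul, optionEquivRight_X_none, map_add, map_mul,
        mul_comm _ (C Polynomial.X), coeff_C_mul, pderiv_X_self, mul_one, hp,
        Polynomial.derivative_mul, Polynomial.derivative_X]
      ring
    | some i =>
      simp only [ycoeff_apply, pderiv_mul, optionEquivRight_X_some, map_mul,
        coeff_mul_X', pderiv_X, Pi.single_apply, reduceCtorEq, if_false, mul_zero, add_zero, hp]
      split_ifs <;> simp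

theorem shamsuddin_apply (a b : Fin r → Polynomial K) (f : PolyRing K r) :
    shamsuddin a b f = pderiv none f +
      ∑ j, (inX (a j) * X (some j) + inX (b j)) * pderiv (some j) f := by
  have h := congrFun (map_sum (Derivation.coeFnAddMonoidHom (R := K) (A := PolyRing K r)
    (M := PolyRing K r)) (fun j => (inX (a j) * X (some j) + inX (b j)) • pderiv (some j))
    Finset.univ) f
  rw [Finset.sum_apply] at h
  rw [shamsuddin, Derivation.add_apply]
  exact congrArg _ h

/-- The action of a Shamsuddin derivation on the coefficients of the monomials in the `y_j`. -/
theorem ycoeff_shamsuddin (a b : Fin r → Polynomial K) (m : Fin r →₀ ℕ) (f : PolyRing K r) :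
    ycoeff m (shamsuddin a b f) = Polynomial.derivative (ycoeff m f) +
      ∑ j, (m j : Polynomial K) * a j * ycoeff m f +
      ∑ j, b j * (ycoeff (m + Finsupp.single j 1) f * (m j + 1)) := by
  classical
  have hD : shamsuddin a b f = pderiv none f +
      ∑ j, (inX (a j) * (X (some j) * pderiv (some j) f) + inX (b j) * pderiv (some j) f) := by
    simp only [shamsuddin_apply, add_mul, mul_assoc]
  rw [hD, map_add, ycoeff_pderiv_none, map_sum, add_assoc, ← Finset.sum_add_distrib]
  congr 1
  refine Finset.sum_congr rfl fun j _ => ?_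
  rw [map_add, ycoeff_inX_mul, ycoeff_inX_mul]
  congr 1
  · have : ycoeff m (X (some j) * pderiv (some j) f) = (m j : Polynomial K) * ycoeff m f := by
      rw [ycoeff_apply, map_mul, optionEquivRight_X_some, optionEquivRight_pderiv_some,
        coeff_X_mul', coeff_pderiv]
      split_ifs with h
      · have h1 : Finsupp.single j 1 ≤ m := by
          rw [Finsupp.single_le_iff]
          exact Nat.one_le_iff_ne_zero.2 (Finsupp.mem_support_iff.1 h)
        have h2 : ((m - Finsupp.single j 1 : Fin r →₀ ℕ) j : Polynomial K) + 1 = m j := by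
          have := h1 j
          rw [Finsupp.single_eq_same] at this
          rw [Finsupp.tsub_apply, Finsupp.single_eq_same]
          exact_mod_cast congrArg (Nat.cast (R := Polynomial K)) (Nat.sub_add_cancel this)
        rw [tsub_add_cancel_of_le h1, h2, ycoeff_apply, mul_comm]
      · simp [Finsupp.notMem_support_iff.1 h]
    rw [this]; ring
  · rw [ycoeff_apply, optionEquivRight_pderiv_some, coeff_pderiv, ycoeff_apply]

theorem shamsuddin_X_none (a b : Fin r → Polynomial K) : shamsuddin a b (X none) = 1 := by
  simp [shamsuddin_apply]

theorem shamsuddin_X_some (a b : Fin r → Polynomial K) (j : Fin r) :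
    shamsuddin a b (X (some j)) = inX (a j) * X (some j) + inX (b j) := by
  classical
  simp [shamsuddin_apply, Pi.single_apply]

theorem shamsuddin_inX (a b : Fin r → Polynomial K) (p : Polynomial K) :
    shamsuddin a b (inX p) = inX (Polynomial.derivative p) := by
  rw [inX, Derivation.map_aeval, shamsuddin_X_none, smul_eq_mul, mul_one]

theorem shamsuddin_C (a b : Fin r → Polynomial K) (c : K) :
    shamsuddin a b (C c) = 0 := by
  rw [← algebraMap_eq]
  exact Derivation.map_algebraMap _ _

theorem inX_C (c : K) : inX (r := r) (Polynomial.C c) = C c := by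
  simp [inX, algebraMap_eq]

theorem inX_injective : Function.Injective (inX (K := K) (r := r)) := fun p q h => by
  have := congrArg (ycoeff 0) h
  simpa [ycoeff_inX] using this

/-! ### Darboux elements and membership in the isotropy group -/

/-- A nonzero Darboux element of a simple derivation is a constant. -/
theorem IsSimpleDerivation.exists_eq_C {D : Derivation K (PolyRing K r) (PolyRing K r)}
    (hD : IsSimpleDerivation D) {f g : PolyRing K r} (h : D f = g * f) : ∃ c, f = C c := by
  have hst : IsStable D (Ideal.span {f}) := by
    intro u hu
    obtain ⟨v, rfl⟩ := Ideal.mem_span_singleton'.1 hu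
    refine Ideal.mem_span_singleton'.2 ⟨v * g + D v, ?_⟩
    rw [D.leibniz, h, smul_eq_mul, smul_eq_mul]
    ring
  rcases hD _ hst with h0 | h1
  · exact ⟨0, by simpa using h0⟩
  · obtain ⟨c, -, hc⟩ := isUnit_iff_eq_C_of_isReduced.1 (Ideal.span_singleton_eq_top.1 h1)
    exact ⟨c, hc⟩

/-- An algebra automorphism lies in the isotropy group if it commutes with the derivation on the
indeterminates. -/
theorem mem_isotropyGroup_of_X {D : Derivation K (PolyRing K r) (PolyRing K r)}
    {ρ : PolyRing K r ≃ₐ[K] PolyRing K r} (h : ∀ i, ρ (D (X i)) = D (ρ (X i))) :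
    ρ ∈ isotropyGroup D := by
  intro f
  induction f using MvPolynomial.induction_on with
  | C c =>
    have h1 : ρ (C c) = C c := ρ.commutes c
    have h2 : D (C c) = 0 := D.map_algebraMap c
    rw [h1, h2, map_zero]
  | add p q hp hq => simp only [map_add, hp, hq]
  | mul_X p i hp =>
    simp only [map_mul, D.leibniz, smul_eq_mul, map_add, hp, h]

/-! ### Shears along a Darboux linear form -/

/-- The endomorphism fixing `x` and the `y_j` with `j ≠ i`, and sending `y_i` to `y_i - e ℓ`,
where `ℓ = ∑ k_j y_j - Q`. -/
noncomputable def shear (k : Fin r → K) (Q : Polynomial K) (i : Fin r) (e : K) :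
    PolyRing K r →ₐ[K] PolyRing K r :=
  aeval fun o => o.elim (X none) fun j =>
    if j = i then X (some i) - C e * (∑ j, C (k j) * X (some j) - inX Q) else X (some j)

section shear

variable (k : Fin r → K) (Q : Polynomial K) (i : Fin r) (e : K)

theorem shear_X_none : shear k Q i e (X none) = X none := by simp [shear]

theorem shear_X_self : shear k Q i e (X (some i)) =
    X (some i) - C e * (∑ j, C (k j) * X (some j) - inX Q) := by simp [shear]

theorem shear_X_of_ne {j : Fin r} (h : j ≠ i) : shear k Q i e (X (some j)) = X (some j) := by
  simp [shear, h]

theorem shear_inX (p : Polynomial K) : shear k Q i e (inX p) = inX p := by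
  rw [inX, ← Polynomial.aeval_algHom_apply, shear_X_none]

theorem shear_C (c : K) : shear k Q i e (C c) = C c := (shear k Q i e).commutes c

theorem shear_form : shear k Q i e (∑ j, C (k j) * X (some j) - inX Q) =
    C (1 - e * k i) * (∑ j, C (k j) * X (some j) - inX Q) := by
  have h : ∑ j, C (k j) * shear k Q i e (X (some j)) = ∑ j, C (k j) * X (some j) -
      C (k i) * (C e * (∑ j, C (k j) * X (some j) - inX Q)) := by
    rw [← Finset.add_sum_erase _ (fun j => C (k j) * shear k Q i e (X (some j)))
      (Finset.mem_univ i), shear_X_self, mul_sub, Finset.sum_congr rfl fun j hj =>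
        congrArg (C (k j) * ·) (shear_X_of_ne k Q i e (Finset.ne_of_mem_erase hj)),
      ← Finset.add_sum_erase _ (fun j => C (k j) * X (some j)) (Finset.mem_univ i)]
    ring
  simp only [map_sub, map_sum, map_mul, shear_C, shear_inX, h, C_1]
  ring

/-- Since `ℓ` is an eigenvector of the shear with eigenvalue `1 - e k_i`, the composite moves `y_i`
by `-(e + e' (1 - e k_i)) ℓ`. -/
theorem shear_comp_shear {e' : K} (h : e + e' * (1 - e * k i) = 0) :
    (shear k Q i e).comp (shear k Q i e') = AlgHom.id K _ := by
  refine MvPolynomial.algHom_ext fun o => ?_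
  rcases o with _ | j
  · simp [shear_X_none]
  · by_cases hj : j = i
    · subst hj
      have h' : (C e : PolyRing K r) + C e' * C (1 - e * k j) = 0 := by
        rw [← C_mul, ← C_add, h, C_0]
      rw [AlgHom.comp_apply, shear_X_self, map_sub, map_mul, shear_form, shear_X_self, shear_C,
        AlgHom.id_apply]
      linear_combination -(∑ j, C (k j) * X (some j) - inX Q) * h'
    · simp [shear_X_of_ne _ _ _ _ hj]

/-- The automorphism underlying `shear`. -/
noncomputable def shearEquiv (h : e * k i ≠ 1) : PolyRing K r ≃ₐ[K] PolyRing K r :=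
  AlgEquiv.ofAlgHom (shear k Q i e) (shear k Q i (-e / (1 - e * k i)))
    (shear_comp_shear k Q i e (by
      have : 1 - e * k i ≠ 0 := sub_ne_zero.2 h.symm
      field_simp
      ring))
    (shear_comp_shear k Q i _ (by
      have : 1 - e * k i ≠ 0 := sub_ne_zero.2 h.symm
      field_simp
      ring))

theorem shearEquiv_mem_isotropyGroup (h : e * k i ≠ 1) {a : Polynomial K}
    {b : Fin r → Polynomial K}
    (hQ : Polynomial.derivative Q = a * Q + ∑ j, Polynomial.C (k j) * b j) :
    shearEquiv k Q i e h ∈ isotropyGroup (shamsuddin (fun _ => a) b) := by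
  refine mem_isotropyGroup_of_X fun o => ?_
  change shear k Q i e _ = shamsuddin (fun _ => a) b (shear k Q i e _)
  rcases o with _ | j
  · rw [shear_X_none, shamsuddin_X_none, map_one]
  · by_cases hj : j = i
    · subst hj
      -- The equation for `Q` says exactly that `D ℓ = a ℓ`.
      have hl : shamsuddin (fun _ => a) b (∑ j, C (k j) * X (some j) - inX Q) =
          inX a * (∑ j, C (k j) * X (some j) - inX Q) := by
        simp only [map_sub, map_sum, Derivation.leibniz, shamsuddin_C, shamsuddin_X_some,
          shamsuddin_inX, hQ, smul_eq_mul, map_add, map_mul, inX_C, mul_sub, mul_add,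
          Finset.sum_add_distrib, Finset.mul_sum, mul_zero, add_zero]
        have : ∑ x, (C (k x) : PolyRing K r) * (inX a * X (some x)) =
            ∑ x, inX a * (C (k x) * X (some x)) :=
          Finset.sum_congr rfl fun x _ => by ring
        rw [this]
        simp
      simp only [shamsuddin_X_some, map_add, map_mul, map_sub, shear_X_self, shear_inX] at hl ⊢
      rw [Derivation.leibniz, shamsuddin_C, map_sub, hl, smul_eq_mul, smul_eq_mul, mul_zero]
      ring
    · rw [shear_X_of_ne k Q i e hj, shamsuddin_X_some, map_add, map_mul, shear_inX, shear_inX,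
        shear_X_of_ne k Q i e hj]

theorem shearEquiv_ne_one (h : e * k i ≠ 1) (he : e ≠ 0) (hk : k i ≠ 0) :
    shearEquiv k Q i e h ≠ 1 := by
  classical
  intro h1
  have h2 : shear k Q i e (X (some i)) = X (some i) := DFunLike.congr_fun h1 (X (some i))
  rw [shear_X_self, sub_eq_self] at h2
  -- Applying `∂_i` to `e ℓ = 0` leaves `e k_i = 0`.
  have h3 := congrArg (pderiv (some i)) h2
  have h4 : pderiv (some i) (inX Q : PolyRing K r) = 0 := by
    rw [inX, Derivation.map_aeval, pderiv_X_of_ne (by simp), smul_zero]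
  simp [Pi.single_apply, h4] at h3
  exact h3.elim he hk

theorem shear_X_self_eq : shear k Q i e (X (some i)) =
    C (1 - e * k i) * X (some i) - ∑ j ∈ Finset.univ.erase i, C (e * k j) * X (some j) +
      C e * inX Q := by
  rw [shear_X_self, ← Finset.add_sum_erase _ _ (Finset.mem_univ i)]
  simp only [C_sub, C_mul, C_1, mul_assoc, ← Finset.mul_sum]
  ring

end shear

/-! ### Degree in the `y_j` and minimal elements of stable ideals -/

/-- The total degree in the variables `y_j`. -/
noncomputable def ydegree (f : PolyRing K r) : ℕ := (optionEquivRight K (Fin r) f).totalDegree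

theorem ycoeff_eq_zero_of_ydegree_lt {f : PolyRing K r} {m : Fin r →₀ ℕ}
    (h : ydegree f < m.degree) : ycoeff m f = 0 :=
  coeff_eq_zero_of_totalDegree_lt h

theorem ydegree_le {f : PolyRing K r} {d : ℕ}
    (h : ∀ m : Fin r →₀ ℕ, d < m.degree → ycoeff m f = 0) : ydegree f ≤ d := by
  refine Finset.sup_le fun m hm => ?_
  by_contra! hlt
  exact mem_support_iff.1 hm (h m hlt)

theorem exists_ycoeff_ne_zero {f : PolyRing K r} (hf : f ≠ 0) :
    ∃ m : Fin r →₀ ℕ, m.degree = ydegree f ∧ ycoeff m f ≠ 0 := by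
  by_contra! h
  have hall : ∀ m : Fin r →₀ ℕ, ydegree f ≤ m.degree → ycoeff m f = 0 := fun m hm =>
    hm.eq_or_lt.elim (fun h' => h m h'.symm) ycoeff_eq_zero_of_ydegree_lt
  rcases Nat.eq_zero_or_pos (ydegree f) with h0 | h0
  · exact hf (ycoeff_ext fun m => by rw [hall m (by omega), map_zero])
  · have := ydegree_le (f := f) (d := ydegree f - 1) fun m hm => hall m (by omega)
    omega

theorem eq_inX_of_ydegree_eq_zero {f : PolyRing K r} (h : ydegree f = 0) :
    f = inX (ycoeff 0 f) := by
  refine ycoeff_ext fun m => ?_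
  rw [ycoeff_inX]
  split_ifs with hm
  · rw [hm]
  · refine ycoeff_eq_zero_of_ydegree_lt ?_
    rw [h, Nat.pos_iff_ne_zero, Ne, Finsupp.degree_eq_zero_iff]
    exact Ne.symm hm

theorem ycoeff_shamsuddin_const (a : Polynomial K) (b : Fin r → Polynomial K) (m : Fin r →₀ ℕ)
    (f : PolyRing K r) :
    ycoeff m (shamsuddin (fun _ => a) b f) = Polynomial.derivative (ycoeff m f) +
      (m.degree : Polynomial K) * a * ycoeff m f +
      ∑ j, b j * (ycoeff (m + Finsupp.single j 1) f * (m j + 1)) := by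
  rw [ycoeff_shamsuddin, ← Finset.sum_mul, ← Finset.sum_mul, Finsupp.degree_eq_sum, Nat.cast_sum]

/-- The `b_j` terms involve only monomials of degree one higher, where `f` has no coefficients. -/
theorem ycoeff_shamsuddin_of_ydegree_le {a : Polynomial K} {b : Fin r → Polynomial K}
    {m : Fin r →₀ ℕ} {f : PolyRing K r} (h : ydegree f ≤ m.degree) :
    ycoeff m (shamsuddin (fun _ => a) b f) = Polynomial.derivative (ycoeff m f) +
      (m.degree : Polynomial K) * a * ycoeff m f := by
  rw [ycoeff_shamsuddin_const, add_eq_left]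
  refine Finset.sum_eq_zero fun j _ => ?_
  rw [ycoeff_eq_zero_of_ydegree_lt (by simpa using Nat.lt_succ_of_le h), zero_mul, mul_zero]

/-- A nonzero stable ideal contains a nonzero element on which the derivation acts as
multiplication by `d a`, where `d` is its degree in the `y_j`. -/
theorem exists_darboux [CharZero K] {a : Polynomial K} {b : Fin r → Polynomial K}
    {I : Ideal (PolyRing K r)} (hI : IsStable (shamsuddin (fun _ => a) b) I) (h0 : I ≠ ⊥) :
    ∃ f ∈ I, f ≠ 0 ∧
      shamsuddin (fun _ => a) b f = inX ((ydegree f : Polynomial K) * a) * f := by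
  classical
  have hex : ∃ d, ∃ f ∈ I, f ≠ 0 ∧ ydegree f = d := by
    obtain ⟨f, hf, hf0⟩ := Submodule.exists_mem_ne_zero_of_ne_bot h0
    exact ⟨_, f, hf, hf0, rfl⟩
  set d := Nat.find hex with hd
  have hmin : ∀ f ∈ I, f ≠ 0 → d ≤ ydegree f := fun f hf hf0 =>
    Nat.find_min' hex ⟨f, hf, hf0, rfl⟩
  -- Second minimization: among elements of least `y`-degree, minimize a bound on the `x`-degrees of
  -- the top coefficients.
  have hex' : ∃ n, ∃ f ∈ I, f ≠ 0 ∧ ydegree f = d ∧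
      ∀ m : Fin r →₀ ℕ, m.degree = d → (ycoeff m f).natDegree ≤ n := by
    obtain ⟨f, hf, hf0, hfd⟩ := Nat.find_spec hex
    refine ⟨(optionEquivRight K (Fin r) f).support.sup
      fun m => (ycoeff m f).natDegree, f, hf, hf0, hfd, fun m _ => ?_⟩
    by_cases hm : m ∈ (optionEquivRight K (Fin r) f).support
    · exact Finset.le_sup (f := fun m => (ycoeff m f).natDegree) hm
    · have : ycoeff m f = 0 := notMem_support_iff.1 hm
      simp [this]
  obtain ⟨f, hf, hf0, hfd, hfn⟩ := Nat.find_spec hex'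
  refine ⟨f, hf, hf0, ?_⟩
  rw [hfd, ← sub_eq_zero]
  -- The top coefficients of `g` are the derivatives of those of `f`, so a nonzero `g` would
  -- contradict the minimality of the second bound.
  set g := shamsuddin (fun _ => a) b f - inX ((d : Polynomial K) * a) * f with hg
  have hgI : g ∈ I := I.sub_mem (hI f hf) (I.mul_mem_left _ hf)
  have hgc : ∀ m : Fin r →₀ ℕ, d ≤ m.degree → ycoeff m g =
      Polynomial.derivative (ycoeff m f) + ((m.degree : Polynomial K) - d) * a * ycoeff m f := by
    intro m hm
    rw [hg, map_sub, ycoeff_inX_mul, ycoeff_shamsuddin_of_ydegree_le (hfd.trans_le hm)]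
    ring
  have hgtop : ∀ m : Fin r →₀ ℕ, m.degree = d →
      ycoeff m g = Polynomial.derivative (ycoeff m f) := by
    intro m hm
    rw [hgc m hm.ge, hm]
    ring
  by_contra hg0
  have hgd : ydegree g = d := by
    refine le_antisymm (ydegree_le fun m hm => ?_) (hmin g hgI hg0)
    rw [hgc m hm.le, ycoeff_eq_zero_of_ydegree_lt (hfd.trans_lt hm)]
    simp
  obtain ⟨m, hm, hmg⟩ := exists_ycoeff_ne_zero hg0
  rw [hgd] at hm
  have hn : Nat.find hex' ≠ 0 := by
    intro hn
    refine hmg ?_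
    rw [hgtop m hm]
    exact Polynomial.derivative_of_natDegree_zero (Nat.le_zero.1 (hn ▸ hfn m hm))
  refine Nat.find_min hex' (Nat.sub_one_lt hn) ⟨g, hgI, hg0, hgd, fun m hm => ?_⟩
  rw [hgtop m hm]
  exact (Polynomial.natDegree_derivative_le _).trans (Nat.sub_le_sub_right (hfn m hm) 1)

/-- If a Shamsuddin derivation with equal coefficients `a` is not simple, then for some
`k ≠ 0` the equation `z' = a z + ∑ k_j b_j` has a polynomial solution. -/
theorem exists_solution_of_not_isSimpleDerivation [CharZero K] {a : Polynomial K}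
    {b : Fin r → Polynomial K} (h : ¬ IsSimpleDerivation (shamsuddin (fun _ => a) b)) :
    ∃ (k : Fin r → K) (Q : Polynomial K), k ≠ 0 ∧
      Polynomial.derivative Q = a * Q + ∑ j, Polynomial.C (k j) * b j := by
  classical
  simp only [IsSimpleDerivation, not_forall, not_or] at h
  obtain ⟨I, hI, hbot, htop⟩ := h
  obtain ⟨f, hf, hf0, hDf⟩ := exists_darboux hI hbot
  have hc : ∀ m : Fin r →₀ ℕ, m.degree = ydegree f →
      ycoeff m f = Polynomial.C ((ycoeff m f).coeff 0) := by
    intro m hm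
    have := congrArg (ycoeff m) hDf
    rw [ycoeff_shamsuddin_of_ydegree_le hm.ge, ycoeff_inX_mul, hm, add_eq_right] at this
    exact Polynomial.eq_C_of_natDegree_eq_zero
      (Polynomial.derivative_eq_zero.1 this)
  obtain ⟨m, hm, hmf⟩ := exists_ycoeff_ne_zero hf0
  -- Otherwise `f` is a nonzero constant and the ideal is everything.
  have hm0 : m ≠ 0 := by
    rintro rfl
    rw [map_zero] at hm
    have hfC : f = C ((ycoeff 0 f).coeff 0) := by
      rw [← inX_C, ← hc 0 (by rw [map_zero, hm])]
      exact eq_inX_of_ydegree_eq_zero hm.symm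
    refine htop (Ideal.eq_top_of_isUnit_mem _ hf ?_)
    rw [hfC]
    refine (IsUnit.mk0 _ fun h0 => hmf ?_).map C
    rw [hc 0 (by rw [map_zero, hm]), h0, map_zero]
  obtain ⟨i, hi⟩ := Finsupp.ne_iff.1 hm0
  obtain ⟨n, rfl⟩ : ∃ n, m = n + Finsupp.single i 1 :=
    ⟨m - Finsupp.single i 1, (tsub_add_cancel_of_le (Finsupp.single_le_iff.2
      (Nat.one_le_iff_ne_zero.2 hi))).symm⟩
  have hd : ydegree f = n.degree + 1 := by rw [← hm]; simp
  set k : Fin r → K := fun j => (ycoeff (n + Finsupp.single j 1) f).coeff 0 * (n j + 1) with hk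
  -- With `z = ycoeff n f`, the coefficient of `y ^ n` in `D f = d a f` reads `z' + (d - 1) a z + ∑
  -- k_j b_j = d a z`; hence the sign.
  refine ⟨fun j => - k j, ycoeff n f, fun h0 => ?_, ?_⟩
  · have h1 : (ycoeff (n + Finsupp.single i 1) f).coeff 0 * ((n i : K) + 1) = 0 :=
      neg_eq_zero.1 (congrFun h0 i)
    rcases mul_eq_zero.1 h1 with h2 | h2
    · exact hmf (by rw [hc _ hm, h2, map_zero])
    · exact Nat.cast_add_one_ne_zero _ h2
  · have h1 := congrArg (ycoeff n) hDf
    rw [ycoeff_shamsuddin_const, ycoeff_inX_mul, hd] at h1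
    have h2 : ∑ j, b j * (ycoeff (n + Finsupp.single j 1) f * (n j + 1)) =
        ∑ j, Polynomial.C (k j) * b j := by
      refine Finset.sum_congr rfl fun j _ => ?_
      rw [hc (n + Finsupp.single j 1) (by rw [hd]; simp), hk]
      simp only [map_mul, map_add, map_natCast, map_one]
      ring
    rw [h2] at h1
    simp only [map_neg, neg_mul, Finset.sum_neg_distrib]
    push_cast at h1
    linear_combination h1

/-! ### Triviality of the isotropy group of a simple derivation -/

/-- For constant `a`, the operator `z ↦ z' - a z` is surjective on polynomials. -/
theorem exists_derivative_eq_C_mul_add [CharZero K] (a : K) (p : Polynomial K) :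
    ∃ q : Polynomial K, Polynomial.derivative q = Polynomial.C a * q + p := by
  induction p using Polynomial.induction_on' with
  | add p q hp hq =>
    obtain ⟨u, hu⟩ := hp
    obtain ⟨v, hv⟩ := hq
    exact ⟨u + v, by rw [Polynomial.derivative_add, hu, hv]; ring⟩
  | monomial n c =>
    by_cases ha : a = 0
    · refine ⟨Polynomial.monomial (n + 1) (c / (n + 1)), ?_⟩
      have : (n : K) + 1 ≠ 0 := Nat.cast_add_one_ne_zero n
      simp [ha, this]
    -- Subtracting `(c / a) x ^ (n + 1)` trades the right-hand side for a monomial of degree `n`.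
    · induction n generalizing c with
      | zero =>
        refine ⟨Polynomial.C (-c / a), ?_⟩
        rw [← Polynomial.C_mul, mul_div_cancel₀ _ ha]
        simp
      | succ n ih =>
        obtain ⟨q, hq⟩ := ih (c / a * (n + 1))
        refine ⟨q - Polynomial.monomial (n + 1) (c / a), ?_⟩
        rw [Polynomial.derivative_sub, hq, Polynomial.derivative_monomial, mul_sub,
          Polynomial.C_mul_monomial, mul_div_cancel₀ _ ha]
        simp

theorem pderiv_some_inX (j : Fin r) (p : Polynomial K) :
    pderiv (some j) (inX p : PolyRing K r) = 0 := by
  rw [inX, Derivation.map_aeval, pderiv_X_of_ne (by simp), smul_zero]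

/-- For constant `a`, solving `q' = a q - b_i` makes `y_i + q` a nonconstant Darboux element. -/
theorem IsSimpleDerivation.natDegree_ne_zero [CharZero K] {a : Polynomial K}
    {b : Fin r → Polynomial K} (hD : IsSimpleDerivation (shamsuddin (fun _ => a) b))
    (i : Fin r) : a.natDegree ≠ 0 := by
  intro ha
  obtain ⟨q, hq⟩ := exists_derivative_eq_C_mul_add (a.coeff 0) (-b i)
  rw [← Polynomial.eq_C_of_natDegree_eq_zero ha] at hq
  obtain ⟨c, hc⟩ := hD.exists_eq_C (f := X (some i) + inX q) (g := inX a) (by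
    rw [map_add, shamsuddin_X_some, shamsuddin_inX, hq, map_add, map_mul, map_neg]
    ring)
  have := congrArg (pderiv (some i)) hc
  rw [map_add, pderiv_X_self, pderiv_some_inX, pderiv_C, add_zero] at this
  exact one_ne_zero this

theorem eq_zero_of_derivative_eq_mul {u q : Polynomial K} (hq : q ≠ 0)
    (h : Polynomial.derivative q = u * q) : u = 0 := by
  by_contra hu
  have h1 := Polynomial.degree_derivative_lt hq
  rw [h, mul_comm] at h1
  exact absurd (Polynomial.degree_le_mul_left q hu) (not_le.2 h1)

/-- If `c ≠ 0`, then `a` takes the same value at the infinitely many points `n c`, so it is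
constant. -/
theorem eq_zero_of_taylor_eq_self [CharZero K] {a : Polynomial K} (ha : a.natDegree ≠ 0) {c : K}
    (h : Polynomial.taylor c a = a) : c = 0 := by
  by_contra hc
  have hev : ∀ n : ℕ, a.eval (n * c) = a.eval 0 := by
    intro n
    induction n with
    | zero => simp
    | succ n ih =>
      rw [← ih]
      conv_rhs => rw [← h, Polynomial.taylor_eval]
      congr 1
      push_cast
      ring
  have : a = Polynomial.C (a.eval 0) := by
    refine Polynomial.eq_of_infinite_eval_eq _ _ (Set.infinite_of_injective_forall_mem
      (f := fun n : ℕ => (n : K) * c) (fun m n hmn => ?_) fun n => ?_)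
    · exact_mod_cast mul_right_cancel₀ hc hmn
    · simpa using hev n
  exact ha (by rw [this, Polynomial.natDegree_C])

/-- A simple Shamsuddin derivation with equal coefficients has trivial isotropy group. -/
theorem IsSimpleDerivation.isotropyGroup_eq_bot [CharZero K] {a : Polynomial K}
    {b : Fin r → Polynomial K} (hD : IsSimpleDerivation (shamsuddin (fun _ => a) b))
    (i : Fin r) : isotropyGroup (shamsuddin (fun _ => a) b) = ⊥ := by
  rw [Subgroup.eq_bot_iff_forall]
  intro ρ hρ
  replace hρ : ∀ f, ρ (shamsuddin (fun _ => a) b f) = shamsuddin (fun _ => a) b (ρ f) := hρ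
  have hρC : ∀ c, ρ (C c) = C c := ρ.commutes
  have ha := hD.natDegree_ne_zero i
  have ha0 : a ≠ 0 := fun h => ha (by simp [h])
  obtain ⟨c, hc⟩ : ∃ c, ρ (X none) - X none = C c := hD.exists_eq_C (g := 0) (by
    rw [map_sub, ← hρ, shamsuddin_X_none, map_one]
    ring)
  have hx : ρ (X none) = inX (Polynomial.X + Polynomial.C c) := by
    rw [map_add, inX_C, ← hc, inX, Polynomial.aeval_X]
    ring
  have hin : ∀ p, ρ (inX p) = inX (Polynomial.taylor c p) := by
    intro p
    have h1 : ρ (inX p) = Polynomial.aeval (ρ (X none)) p :=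
      (Polynomial.aeval_algHom_apply ρ.toAlgHom _ p).symm
    rw [h1, hx, Polynomial.aeval_algHom_apply, Polynomial.taylor_apply, Polynomial.comp,
      Polynomial.aeval_def, Polynomial.algebraMap_eq]
  have hy : ∀ j, shamsuddin (fun _ => a) b (ρ (X (some j))) =
      inX (Polynomial.taylor c a) * ρ (X (some j)) + inX (Polynomial.taylor c (b j)) := by
    intro j
    rw [← hρ, shamsuddin_X_some, map_add, map_mul, hin, hin]
  -- `ρ` maps `K[x]` onto itself, so by injectivity `ρ(y_i)` lies outside `K[x]`.
  have hd : ydegree (ρ (X (some i))) ≠ 0 := by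
    intro h0
    have h1 := eq_inX_of_ydegree_eq_zero h0
    set q := ycoeff 0 (ρ (X (some i)))
    have h2 : ρ (X (some i)) = ρ (inX (Polynomial.taylor (-c) q)) := by
      rw [hin, Polynomial.taylor_taylor, h1]
      simp
    have h3 := congrArg (pderiv (some i)) (ρ.injective h2)
    rw [pderiv_X_self, pderiv_some_inX] at h3
    exact one_ne_zero h3
  have hc0 : c = 0 := by
    obtain ⟨m, hm, hmq⟩ := exists_ycoeff_ne_zero (f := ρ (X (some i))) fun h => hd (by
      simp [h, ydegree])
    have hm0 : (0 : Fin r →₀ ℕ) ≠ m := by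
      rintro rfl
      exact hd (by rw [← hm, map_zero])
    have h1 := congrArg (ycoeff m) (hy i)
    rw [ycoeff_shamsuddin_of_ydegree_le hm.ge, map_add, ycoeff_inX_mul, ycoeff_inX, if_neg hm0,
      add_zero] at h1
    -- A top coefficient `q` satisfies `q' = (a(x + c) - |m| a) q`, so the factor vanishes by
    -- degree; comparing leading coefficients then gives `|m| = 1`.
    have h2 := eq_zero_of_derivative_eq_mul hmq
      (u := Polynomial.taylor c a - (m.degree : Polynomial K) * a) (by linear_combination h1)
    rw [sub_eq_zero] at h2
    have h3 := congrArg (Polynomial.coeff · a.natDegree) h2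
    simp only [Polynomial.coeff_taylor_natDegree, Polynomial.coeff_natCast_mul,
      Polynomial.coeff_natDegree] at h3
    have h4 : (m.degree : K) = 1 :=
      mul_right_cancel₀ (Polynomial.leadingCoeff_ne_zero.2 ha0) (by rw [← h3, one_mul])
    have h5 : m.degree = 1 := by exact_mod_cast h4
    rw [h5, Nat.cast_one, one_mul] at h2
    exact eq_zero_of_taylor_eq_self ha h2
  subst hc0
  have hyj : ∀ j, ρ (X (some j)) = X (some j) := by
    intro j
    have h1 : shamsuddin (fun _ => a) b (ρ (X (some j)) - X (some j)) =
        inX a * (ρ (X (some j)) - X (some j)) := by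
      rw [map_sub, hy, shamsuddin_X_some, Polynomial.taylor_zero, Polynomial.taylor_zero]
      ring
    obtain ⟨e, he⟩ := hD.exists_eq_C h1
    rw [he, shamsuddin_C, eq_comm, mul_eq_zero] at h1
    rcases h1 with h1 | h1
    · exact absurd (inX_injective (h1.trans (map_zero _).symm)) ha0
    · exact sub_eq_zero.1 (he.trans h1)
  refine AlgEquiv.ext fun f => ?_
  refine DFunLike.congr_fun (f := ρ.toAlgHom) (g := AlgHom.id K _)
    (MvPolynomial.algHom_ext fun o => ?_) f
  rcases o with _ | j
  · change ρ (X none) = X none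
    rw [hx, map_zero, add_zero, inX, Polynomial.aeval_X]
  · exact hyj j

end

end ShamsuddinIsotropy

theorem theorem2p3 {K : Type*} [Field K] [CharZero K] (r : ℕ) (hr : 1 ≤ r)
    (a : Polynomial K) (b : Fin r → Polynomial K) :
    (ShamsuddinIsotropy.IsSimpleDerivation (ShamsuddinIsotropy.shamsuddin (fun _ => a) b) ↔
      ShamsuddinIsotropy.isotropyGroup (ShamsuddinIsotropy.shamsuddin (fun _ => a) b) = ⊥) ∧
    ∀ (k : Fin r → K) (Q : Polynomial K),
      Polynomial.derivative Q = a * Q + ∑ j : Fin r, Polynomial.C (k j) * b j →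
      ∀ i : Fin r, k i ≠ 0 → ∀ e : K, e ≠ 0 → e * k i ≠ 1 →
        ∃ ρ ∈ ShamsuddinIsotropy.isotropyGroup (ShamsuddinIsotropy.shamsuddin (fun _ => a) b),
          ρ ≠ 1 ∧
          ρ (MvPolynomial.X none) = MvPolynomial.X none ∧
          (∀ j : Fin r, j ≠ i →
            ρ (MvPolynomial.X (some j)) = MvPolynomial.X (some j)) ∧
          ρ (MvPolynomial.X (some i)) =
            MvPolynomial.C (1 - e * k i) * MvPolynomial.X (some i)
              - ∑ j ∈ Finset.univ.erase i, MvPolynomial.C (e * k j) * MvPolynomial.X (some j)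
              + MvPolynomial.C e * ShamsuddinIsotropy.inX Q := by
  classical
  have hsol : ∀ (k : Fin r → K) (Q : Polynomial K),
      Polynomial.derivative Q = a * Q + ∑ j : Fin r, Polynomial.C (k j) * b j →
      ∀ i : Fin r, k i ≠ 0 → ∀ e : K, e ≠ 0 → (he : e * k i ≠ 1) →
        ShamsuddinIsotropy.shearEquiv k Q i e he ∈ ShamsuddinIsotropy.isotropyGroup
          (ShamsuddinIsotropy.shamsuddin (fun _ => a) b) ∧
        ShamsuddinIsotropy.shearEquiv k Q i e he ≠ 1 := fun k Q hQ i hk e he0 he =>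
    ⟨ShamsuddinIsotropy.shearEquiv_mem_isotropyGroup k Q i e he hQ,
      ShamsuddinIsotropy.shearEquiv_ne_one k Q i e he he0 hk⟩
  -- An index is needed here: for `r = 0` the derivation `∂_x` is simple but commutes with
  -- translations.
  refine ⟨⟨fun hD => hD.isotropyGroup_eq_bot ⟨0, hr⟩, fun hbot => ?_⟩,
    fun k Q hQ i hk e he0 he => ?_⟩
  · by_contra hD
    obtain ⟨k, Q, hk, hQ⟩ :=
      ShamsuddinIsotropy.exists_solution_of_not_isSimpleDerivation hD
    obtain ⟨i, hi⟩ := Function.ne_iff.1 hk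
    replace hi : k i ≠ 0 := hi
    -- With `e k_i = 2` the shear sends `ℓ` to `-ℓ`; the choice is admissible over every `K`.
    have he : 2 / k i * k i ≠ 1 := by
      rw [div_mul_cancel₀ _ hi]
      exact OfNat.ofNat_ne_one 2
    obtain ⟨hmem, hne⟩ := hsol k Q hQ i hi (2 / k i) (div_ne_zero two_ne_zero hi) he
    rw [hbot] at hmem
    exact hne (Subgroup.mem_bot.1 hmem)
  · obtain ⟨hmem, hne⟩ := hsol k Q hQ i hk e he0 he
    exact ⟨_, hmem, hne, ShamsuddinIsotropy.shear_X_none k Q i e,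
      fun j hj => ShamsuddinIsotropy.shear_X_of_ne k Q i e hj,
      ShamsuddinIsotropy.shear_X_self_eq k Q i e⟩
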